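/- Conventions. Let $\mathbb{N}=\{1,2,3,\dots\}$, and let all spaces be over the same scalar field, $\mathbb{R}$ or $\mathbb{C}$. The Schreier families $\mathcal{S}_\xi$ of finite subsets of $\mathbb{N}$, $0\le\xi<\omega_1$, are defined by $\mathcal{S}_0=\{\{n\}:n\in\mathbb{N}\}\cup\{\emptyset\}$ and $\mathcal{S}_1=\{F:\#F\le\min F\}\cup\{\emptyset\}$; for $\xi=\zeta+1$ with $\zeta\ge1$, $\mathcal{S}_\xi$ consists of $\emptyset$ and all unions $F_1\cup\dots\cup F_n$ of non-empty sets $F_1<\dots<F_n$ in $\mathcal{S}_\zeta$ with $\{\min F_1,\dots,\min F_n\}\in\mathcal{S}_1$; for $\xi$ a limit ordinal, $\mathcal{S}_\xi=\bigcup_{n\ge1}\{F\in\mathcal{S}_{\zeta_n}: n\le \min F\text{ or }F=\emptyset\}$, where $(\zeta_n)$ is a fixed strictly increasing sequence of non-limit ordinals with supremum $\xi$ (chosen arbitrarily for each countable limit ordinal $\xi$). For Banach spaces $X,Y$, $1\le p\le\infty$, $0\le C<\infty$ and $1\le\xi<\omega_1$, let $\mathcal{WD}_{\ell_p}^{(C,\xi)}(X,Y)$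 be the set of all bounded linear operators $T:X\to Y$ such that for every $\epsilon>0$, every normalized weakly null sequence $(x_n)$ in $X$ has a subsequence $(x_{n_k})$ with $$\Big\|\sum_k\alpha_kTx_{n_k}\Big\|\le(C+\epsilon)\,\|(\alpha_k)\|_{\ell_p}$$ for all finitely supported scalar sequences $(\alpha_k)_{k\ge1}$ whose support belongs to $\mathcal{S}_\xi$. Let $\mathcal{WD}_{\ell_p}^{(\infty,\xi)}(X,Y)=\bigcup_{0\le C<\infty}\mathcal{WD}_{\ell_p}^{(C,\xi)}(X,Y)$. Statement. Let $X$ be a Banach space which contains no subspace isomorphic to $\ell_1$. Let $1\le q<p\le\infty$, $0\le C\le\infty$, and let $\xi$ be a countable ordinal with $1\le\xi<\omega_1$. Then, for every choice of the sequences used to define the Schreier families at limit ordinals, $$\mathcal{WD}_{\ell_p}^{(C,\xi)}(X,\ell_q)=\mathcal{K}(X,\ell_q),$$ the set of all compact operators from $X$ to $\ell_q$. -/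

import Mathlib

open Filter Topology
open scoped ENNReal NNReal

/-- A choice, for every countable limit ordinal `ξ`, of a strictly increasing sequence
`(s ξ n)_{n ≥ 1}` of non-limit ordinals with supremum `ξ`. -/
def IsLimitSystem (s : Ordinal.{0} → ℕ+ → Ordinal.{0}) : Prop :=
  ∀ ξ : Ordinal.{0}, ξ < Ordinal.omega 1 → Order.IsSuccLimit ξ →
    StrictMono (s ξ) ∧ (∀ n, ¬ Order.IsSuccLimit (s ξ n)) ∧ IsLUB (Set.range (s ξ)) ξ

/-- The first Schreier family: finite `F ⊆ {1, 2, …}` with `#F ≤ min F`, together with `∅`. -/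
def schreierOne : Set (Finset ℕ+) :=
  {F | ∀ n ∈ F, F.card ≤ (n : ℕ)}

/-- `IsSchreier s ξ F` says that `F` belongs to the Schreier family `𝒮_ξ`, built with the
sequences `s` at limit ordinals. Exactly one of the clauses `zero`, `one`, `succ`, `limit` applies
to each `ξ`; the clause `empty` puts `∅` into every family. -/
inductive IsSchreier (s : Ordinal.{0} → ℕ+ → Ordinal.{0}) :
    Ordinal.{0} → Finset ℕ+ → Prop
  | empty (ξ : Ordinal.{0}) : IsSchreier s ξ ∅
  | zero (n : ℕ+) : IsSchreier s 0 {n}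
  | one (F : Finset ℕ+) (hF : F ∈ schreierOne) : IsSchreier s 1 F
  | succ (η : Ordinal.{0}) (hη : 1 ≤ η) (n : ℕ) (F : Fin n → Finset ℕ+)
      (hne : ∀ i, (F i).Nonempty)
      (hF : ∀ i, IsSchreier s η (F i))
      (hlt : ∀ i j, i < j → ∀ a ∈ F i, ∀ b ∈ F j, a < b)
      (hmin : Finset.univ.image (fun i => (F i).min' (hne i)) ∈ schreierOne) :
      IsSchreier s (η + 1) (Finset.univ.biUnion F)
  | limit (ξ : Ordinal.{0}) (hξ : Order.IsSuccLimit ξ) (n : ℕ+) (F : Finset ℕ+)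
      (hF : IsSchreier s (s ξ n) F) (hn : ∀ a ∈ F, n ≤ a) : IsSchreier s ξ F

/-- The Schreier family `𝒮_ξ`. -/
def schreierFamily (s : Ordinal.{0} → ℕ+ → Ordinal.{0}) (ξ : Ordinal.{0}) :
    Set (Finset ℕ+) :=
  {F | IsSchreier s ξ F}

section

variable (𝕜 : Type*) [RCLike 𝕜]

/-- `ℓ_p`, the scalar sequences with finite `p`-norm. -/
abbrev SeqLp (p : ℝ≥0∞) : Type _ := lp (fun _ : ℕ+ => 𝕜) p

variable {𝕜}

/-- A finitely supported scalar sequence as an element of `ℓ_p`. -/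
noncomputable def toSeqLp (p : ℝ≥0∞) (α : ℕ+ →₀ 𝕜) : SeqLp 𝕜 p :=
  ⟨⇑α, (memℓp_zero (E := fun _ : ℕ+ => 𝕜)
    (α.support.finite_toSet.subset fun _ h => Finsupp.mem_support_iff.2 h)).of_exponent_ge
      zero_le⟩

variable (𝕜)

/-- `X` contains a copy of `E`: there is a linear isomorphism of `E` onto a subspace of `X`,
that is, a bounded linear operator from `E` to `X` that is bounded below. -/
def ContainsCopy (E X : Type*) [NormedAddCommGroup E] [NormedSpace 𝕜 E]
    [NormedAddCommGroup X] [NormedSpace 𝕜 X] : Prop :=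
  ∃ J : E →L[𝕜] X, ∃ c : ℝ, 0 < c ∧ ∀ a : E, c * ‖a‖ ≤ ‖J a‖

variable {X : Type*} [NormedAddCommGroup X] [NormedSpace 𝕜 X]

/-- `(x_n)` is normalized and converges weakly to `0`. -/
def IsNormalizedWeaklyNull (x : ℕ+ → X) : Prop :=
  (∀ n, ‖x n‖ = 1) ∧ ∀ f : X →L[𝕜] 𝕜, Tendsto (fun n => f (x n)) atTop (𝓝 0)

variable (X) (Y : Type*) [NormedAddCommGroup Y] [NormedSpace 𝕜 Y]

/-- The class `WD_{ℓ_p}^{(C,ξ)}(X,Y)` for finite `C`. -/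
def finiteWD (s : Ordinal.{0} → ℕ+ → Ordinal.{0}) (p : ℝ≥0∞) (C : ℝ≥0) (ξ : Ordinal.{0}) :
    Set (X →L[𝕜] Y) :=
  {T | ∀ ε : ℝ, 0 < ε → ∀ x : ℕ+ → X, IsNormalizedWeaklyNull 𝕜 x →
    ∃ φ : ℕ+ → ℕ+, StrictMono φ ∧
      ∀ α : ℕ+ →₀ 𝕜, α.support ∈ schreierFamily s ξ →
        ‖α.sum fun k a => a • T (x (φ k))‖ ≤ ((C : ℝ) + ε) * ‖toSeqLp p α‖}

open Classical in
/-- The class `WD_{ℓ_p}^{(C,ξ)}(X,Y)` for `0 ≤ C ≤ ∞`; for `C = ∞` it is the union over all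
finite constants. -/
def classWD (s : Ordinal.{0} → ℕ+ → Ordinal.{0}) (p : ℝ≥0∞) (C : ℝ≥0∞) (ξ : Ordinal.{0}) :
    Set (X →L[𝕜] Y) :=
  if C = ∞ then ⋃ D : ℝ≥0, finiteWD 𝕜 X Y s p D ξ else finiteWD 𝕜 X Y s p C.toNNReal ξ

end

/-! Every compact operator lies in the class for each constant: it sends a normalized weakly null
sequence to a norm-null one, and a subsequence with geometrically decaying images satisfies the
estimate for any exponent, because coefficients are bounded by the `ℓ_p` norm.

Conversely, let `T` be in the class. If `T` kept some normalized weakly null sequence away from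
zero, a gliding hump in `ℓ_q` would give sums of `n` images of norm of order at least `n^(1/q)`.
Sets of size `n` lying far enough out are in every Schreier family of index at least 1, so the same
sums are at most of order `n^(1/p)`, which is impossible for large `n` since `q < p`
(`not_bounded_below_of_mem_finiteWD`). Only this consequence of the Schreier structure is used, so
the class depends neither on `ξ` nor on `C`.

Compactness then follows from Rosenthal's `ℓ₁` theorem (`exists_weaklyCauchy_subsequence`): bounded
sequences have weakly Cauchy subsequences, and a failure of norm convergence of the images would
give weakly null differences with images bounded below. Rosenthal's theorem rests on a dichotomy
along a nonprincipal ultrafilter: sets of functionals are Boolean independent along a subsequence,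
which produces `ℓ₁`, or alternating intersections become empty along almost every branch, which
prevents two cluster values. -/

/-! ### Diagonalisation and a Ramsey-type dichotomy along an ultrafilter -/

/-- Diagonal extraction: a sequence whose terms lie in the sets `g j` attached to all increasing
lists of earlier terms. -/
theorem exists_diagonal_sequence {U : Filter ℕ} [U.NeBot] (hU : U ≤ atTop)
    (g : ℕ → List ℕ → Set ℕ) (hg : ∀ j l, g j l ∈ U) :
    ∃ m : ℕ → ℕ, StrictMono m ∧ ∀ k, ∀ j ≤ k, ∀ l : List ℕ, l.Pairwise (· < ·) →
      (∀ a ∈ l, a < k) → m k ∈ g j (l.map m) := by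
  have key : ∀ h : List ℕ, ∃ n, (∀ a ∈ h, a < n) ∧
      ∀ j ≤ h.length, ∀ l, l.Sublist h → n ∈ g j l := by
    intro h
    have h1 : ∀ᶠ n in U, ∀ a ∈ h, a < n := by
      have : ∀ᶠ n in U, ∀ a ∈ {a | a ∈ h}, a < n :=
        (eventually_all_finite (List.finite_toSet h)).2 fun a _ => hU (eventually_gt_atTop a)
      exact this
    -- Only finitely many indices `j` and sublists of the history are active at each stage, so a
    -- filter can meet all their conditions at once.
    have h2 : ∀ᶠ n in U, ∀ j ∈ Set.Iic h.length, ∀ l ∈ {l | l ∈ h.sublists}, n ∈ g j l :=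
      (eventually_all_finite (Set.finite_Iic _)).2 fun j _ =>
        (eventually_all_finite (List.finite_toSet _)).2 fun l _ => hg j l
    obtain ⟨n, hn1, hn2⟩ := (h1.and h2).exists
    exact ⟨n, hn1, fun j hj l hl => hn2 j hj l (List.mem_sublists.2 hl)⟩
  choose next hnext1 hnext2 using key
  let hist : ℕ → List ℕ := fun k => Nat.rec [] (fun _ h => h ++ [next h]) k
  let m : ℕ → ℕ := fun k => next (hist k)
  have hist_eq : ∀ k, hist k = (List.range k).map m := by
    intro k
    induction k with
    | zero => rfl
    | succ k ih =>
      rw [List.range_succ, List.map_append, ← ih]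
      rfl
  refine ⟨m, strictMono_nat_of_lt_succ fun k => ?_, fun k j hj l hl hlk => ?_⟩
  · refine hnext1 (hist (k + 1)) _ ?_
    change next (hist k) ∈ hist k ++ [next (hist k)]
    simp
  · refine hnext2 (hist k) j (by simpa [hist_eq] using hj) _ ?_
    rw [hist_eq]
    refine List.Sublist.map m ?_
    refine List.sublist_of_subperm_of_pairwise (r := (· < ·)) ?_ hl List.pairwise_lt_range
    exact List.subperm_of_subset (hl.imp fun h => h.ne) fun a ha => by simpa using hlk a ha

/-- The lists `s` such that `U`-almost all ways of extending `s` step by step lead into `F`. -/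
inductive EventuallyHits (U : Filter ℕ) (F : Set (List ℕ)) : List ℕ → Prop
  | base (s : List ℕ) (hs : s ∈ F) : EventuallyHits U F s
  | step (s : List ℕ) (W : Set ℕ) (hW : W ∈ U) (h : ∀ n ∈ W, EventuallyHits U F (s ++ [n])) :
      EventuallyHits U F s

/-- The inductive derivation is a well-founded tree; recording its branching sets in one function
`g` makes every branch obeying `g` stop in `F`. -/
theorem EventuallyHits.exists_tree {U : Filter ℕ} {F : Set (List ℕ)} {s : List ℕ}
    (h : EventuallyHits U F s) :
    ∃ g : List ℕ → Set ℕ, (∀ l, g l ∈ U) ∧ ∀ v : ℕ → ℕ,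
      (∀ i, v i ∈ g ((List.range i).map v)) → ∃ i, s ++ (List.range i).map v ∈ F := by
  classical
  induction h with
  | base s hs => exact ⟨fun _ => Set.univ, fun _ => univ_mem, fun v _ => ⟨0, by simpa using hs⟩⟩
  | step s W hW h ih =>
    choose! g hg hgF using ih
    let G : List ℕ → Set ℕ := fun l => match l with
      | [] => W
      | n :: t => if n ∈ W then g n t else Set.univ
    refine ⟨G, fun l => ?_, fun v hv => ?_⟩
    · cases l with
      | nil => exact hW
      | cons n t =>
        by_cases hn : n ∈ W
        · simpa [G, hn] using hg n hn t
        · simp [G, hn]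
    · have h0 : v 0 ∈ W := hv 0
      obtain ⟨i, hi⟩ := hgF (v 0) h0 (fun i => v (i + 1)) fun i => by
        have := hv (i + 1)
        rw [List.range_succ_eq_map] at this
        simpa [G, h0, Function.comp_def] using this
      refine ⟨i + 1, ?_⟩
      rw [List.range_succ_eq_map]
      simpa [Function.comp_def] using hi

/-- If a list does not eventually hit `F`, the set of its hitting one-step extensions is not in `U`,
so the complement is: this is where an ultrafilter is needed. Diagonalising keeps every increasing
list in the non-hitting state. -/
theorem EventuallyHits.exists_avoiding {U : Ultrafilter ℕ} (hU : (U : Filter ℕ) ≤ atTop)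
    {F : Set (List ℕ)} (h : ¬ EventuallyHits U F []) :
    ∃ m : ℕ → ℕ, StrictMono m ∧ ∀ l : List ℕ, l.Pairwise (· < ·) → l.map m ∉ F := by
  classical
  let g : List ℕ → Set ℕ := fun s =>
    if EventuallyHits U F s then Set.univ else {n | ¬ EventuallyHits U F (s ++ [n])}
  have hg : ∀ s, g s ∈ (U : Filter ℕ) := by
    intro s
    by_cases hs : EventuallyHits U F s
    · simp [g, hs]
    · simp only [g, hs, if_false]
      have : {n | EventuallyHits U F (s ++ [n])} ∉ U := fun hW => hs (.step s _ hW fun n hn => hn)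
      exact Ultrafilter.compl_mem_iff_notMem.2 this
  obtain ⟨m, hm, hmg⟩ := exists_diagonal_sequence hU (fun _ => g) (fun _ => hg)
  refine ⟨m, hm, ?_⟩
  have : ∀ l : List ℕ, l.Pairwise (· < ·) → ¬ EventuallyHits U F (l.map m) := by
    intro l
    induction l using List.reverseRecOn with
    | nil => exact fun _ => h
    | append_singleton l k ih =>
      intro hl
      rw [List.pairwise_append] at hl
      have h1 := ih hl.1
      have h2 := hmg k 0 (Nat.zero_le _) l hl.1 fun a ha => hl.2.2 a ha k (by simp)
      simpa [g, h1] using h2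
  exact fun l hl hF => this l hl (.base _ hF)

/-! ### Alternating intersections and Boolean independence -/

/-- The intersection `C b n₀ ∩ C (!b) n₁ ∩ C b n₂ ∩ ⋯` along a list. -/
def alternatingInter {S : Type*} (C : Bool → ℕ → Set S) : Bool → List ℕ → Set S
  | _, [] => Set.univ
  | b, n :: l => C b n ∩ alternatingInter C (!b) l

theorem mem_alternatingInter_map_range {S : Type*} {C : Bool → ℕ → Set S} {x : S} (i : ℕ) :
    ∀ (b : Bool) (v : ℕ → ℕ), (∀ k, x ∈ C (xor b (k % 2 == 1)) (v k)) →
      x ∈ alternatingInter C b ((List.range i).map v) := by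
  induction i with
  | zero => intro b v _; exact Set.mem_univ x
  | succ i ih =>
    intro b v h
    rw [List.range_succ_eq_map, List.map_cons, List.map_map]
    refine ⟨by simpa using h 0, ih (!b) _ fun k => ?_⟩
    have := h (k + 1)
    rcases Nat.mod_two_eq_zero_or_one k with hk | hk <;>
      simpa [Nat.add_mod, hk] using this

/-- Arbitrary sign patterns embed in alternating ones: only odd positions carry prescribed signs,
and position `2 * i` serves as a dummy entry when the alternation would give the wrong sign at `2 *
i + 1`. -/
theorem exists_padding {S : Type*} (C : Bool → ℕ → Set S) (m : ℕ → ℕ) (e : ℕ → Bool)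
    (L : List ℕ) : L.Pairwise (· < ·) → ∀ b, ∃ l : List ℕ, l.Pairwise (· < ·) ∧
      (∀ a ∈ l, ∃ i ∈ L, 2 * i ≤ a) ∧
      ∀ x ∈ alternatingInter C b (l.map m), ∀ i ∈ L, x ∈ C (e i) (m (2 * i + 1)) := by
  induction L with
  | nil => exact fun _ b => ⟨[], by simp, by simp, by simp⟩
  | cons i L ih =>
    intro hL b
    rw [List.pairwise_cons] at hL
    obtain ⟨l, hl, hlL, hx⟩ := ih hL.2 (!(e i))
    have hgt : ∀ a ∈ l, 2 * i + 1 < a := fun a ha => by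
      obtain ⟨i', hi', h⟩ := hlL a ha
      have := hL.1 i' hi'
      omega
    by_cases hb : e i = b
    · subst hb
      refine ⟨(2 * i + 1) :: l, List.pairwise_cons.2 ⟨hgt, hl⟩, ?_, ?_⟩
      · intro a ha
        refine ⟨i, by simp, ?_⟩
        rcases List.mem_cons.1 ha with rfl | ha
        · omega
        · have := hgt a ha; omega
      · rintro x ⟨hx1, hx2⟩ i' hi'
        rcases List.mem_cons.1 hi' with rfl | hi'
        · exact hx1
        · exact hx x hx2 i' hi'
    · have hb' : (!b) = e i := by cases h : e i <;> cases b <;> simp_all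
      refine ⟨(2 * i) :: (2 * i + 1) :: l, ?_, ?_, ?_⟩
      · refine List.pairwise_cons.2 ⟨fun a ha => ?_, List.pairwise_cons.2 ⟨hgt, hl⟩⟩
        rcases List.mem_cons.1 ha with rfl | ha
        · omega
        · have := hgt a ha; omega
      · intro a ha
        refine ⟨i, by simp, ?_⟩
        rcases List.mem_cons.1 ha with rfl | ha
        · omega
        rcases List.mem_cons.1 ha with rfl | ha
        · omega
        · have := hgt a ha; omega
      · rintro x ⟨-, hx1, hx2⟩ i' hi'
        rw [hb'] at hx1 hx2
        rcases List.mem_cons.1 hi' with rfl | hi'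
        · exact hx1
        · exact hx x hx2 i' hi'

/-- Either some subsequence of the pairs `(C true n, C false n)` is Boolean independent, or
`U`-almost all subsequences have an empty alternating intersection. -/
theorem exists_independent_of_not_eventuallyHits {S : Type*} (C : Bool → ℕ → Set S)
    {U : Ultrafilter ℕ} (hU : (U : Filter ℕ) ≤ atTop)
    (h : ¬ EventuallyHits U {l | alternatingInter C true l = ∅} []) :
    ∃ m : ℕ → ℕ, StrictMono m ∧ ∀ (F : Finset ℕ) (e : ℕ → Bool), ∃ x, ∀ i ∈ F,
      x ∈ C (e i) (m i) := by
  obtain ⟨m, hm, hmF⟩ := EventuallyHits.exists_avoiding hU h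
  refine ⟨fun i => m (2 * i + 1), hm.comp fun i j hij => by omega, fun F e => ?_⟩
  obtain ⟨l, hl, -, hx⟩ := exists_padding C m e (F.sort (· ≤ ·))
    (F.sortedLT_sort.pairwise) true
  obtain ⟨x, hx'⟩ := Set.nonempty_iff_ne_empty.2 (hmF l hl)
  exact ⟨x, fun i hi => hx x hx' i ((Finset.mem_sort _).2 hi)⟩

/-! ### Rosenthal's `ℓ₁` theorem -/

section Rosenthal

variable {𝕜 : Type*} [RCLike 𝕜] {X : Type*} [NormedAddCommGroup X] [NormedSpace 𝕜 X]

theorem containsCopy_of_lower_bound [CompleteSpace X] (u : ℕ+ → X) {K κ : ℝ} (hκ : 0 < κ)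
    (hK : ∀ n, ‖u n‖ ≤ K)
    (h : ∀ (F : Finset ℕ+) (a : ℕ+ → 𝕜), κ * ∑ i ∈ F, ‖a i‖ ≤ ‖∑ i ∈ F, a i • u i‖) :
    ContainsCopy 𝕜 (SeqLp 𝕜 1) X := by
  have hnorm : ∀ a : SeqLp 𝕜 1, HasSum (fun n => ‖a n‖) ‖a‖ := fun a => by
    simpa using lp.hasSum_norm (p := 1) (by simp) a
  have hbd : ∀ (a : SeqLp 𝕜 1) n, ‖a n • u n‖ ≤ ‖a n‖ * K := fun a n => by
    rw [norm_smul]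
    exact mul_le_mul_of_nonneg_left (hK n) (norm_nonneg _)
  have hsum : ∀ a : SeqLp 𝕜 1, Summable fun n => a n • u n := fun a =>
    Summable.of_norm_bounded ((hnorm a).summable.mul_right K) (hbd a)
  let J : SeqLp 𝕜 1 →ₗ[𝕜] X :=
    { toFun := fun a => ∑' n, a n • u n
      map_add' := fun a b => by
        rw [← (hsum a).tsum_add (hsum b)]
        exact tsum_congr fun n => by simp [add_smul]
      map_smul' := fun c a => by
        rw [RingHom.id_apply, ← (hsum a).tsum_const_smul c]
        exact tsum_congr fun n => by simp [mul_smul] }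
  refine ⟨J.mkContinuous K fun a => ?_, κ, hκ, fun a => ?_⟩
  · rw [mul_comm]
    exact tsum_of_norm_bounded ((hnorm a).mul_right K) (hbd a)
  · exact le_of_tendsto_of_tendsto' ((hnorm a).const_mul κ |>.congr fun F => by
      rw [Finset.mul_sum]) (hsum a).hasSum.norm fun F => h F a

/-- If every sign pattern is realised, up to small errors, by norm-one functionals taking values
near `c` or `d`, then the vectors span a copy of `ℓ₁`. -/
theorem norm_sum_ge_of_separated {ι : Type*} (F : Finset ι) (u : ι → X) (c : Bool → 𝕜) (r : ℝ)
    (hr : 8 * r ≤ ‖c true - c false‖)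
    (h : ∀ e : ι → Bool, ∃ f : X →L[𝕜] 𝕜, ‖f‖ ≤ 1 ∧ ∀ i ∈ F, ‖f (u i) - c (e i)‖ ≤ r)
    (a : ι → 𝕜) :
    ‖c true - c false‖ / 8 * ∑ i ∈ F, ‖a i‖ ≤ ‖∑ i ∈ F, a i • u i‖ := by
  classical
  set w := c true - c false with hw
  have key : ∀ b : ι → 𝕜, ∑ i ∈ F, |RCLike.re (b i * w)| - 2 * r * ∑ i ∈ F, ‖b i‖ ≤
      2 * ‖∑ i ∈ F, b i • u i‖ := by
    intro b
    -- Two functionals with opposite patterns, chosen so that each term of `f - g` has real part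
    -- about `|re (b i * w)|`.
    obtain ⟨f, hf1, hf⟩ := h fun i => decide (0 ≤ RCLike.re (b i * w))
    obtain ⟨g, hg1, hg⟩ := h fun i => !decide (0 ≤ RCLike.re (b i * w))
    have h1 : ‖(f - g) (∑ i ∈ F, b i • u i)‖ ≤ 2 * ‖∑ i ∈ F, b i • u i‖ := by
      refine ((f - g).le_opNorm _).trans (mul_le_mul_of_nonneg_right ?_ (norm_nonneg _))
      have := norm_sub_le f g
      linarith
    refine le_trans ?_ ((RCLike.re_le_norm _).trans h1)
    rw [map_sum, map_sum, Finset.mul_sum, ← Finset.sum_sub_distrib]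
    refine Finset.sum_le_sum fun i hi => ?_
    have hfi := hf i hi
    have hgi := hg i hi
    rw [map_smul, smul_eq_mul]
    have herr : ∀ z : 𝕜, ‖(f - g) (u i) - z‖ ≤ 2 * r →
        RCLike.re (b i * z) - 2 * r * ‖b i‖ ≤ RCLike.re (b i * (f - g) (u i)) := by
      intro z hz
      have h2 : RCLike.re (b i * z - b i * (f - g) (u i)) ≤ ‖b i‖ * (2 * r) := by
        refine (RCLike.re_le_norm _).trans ?_
        rw [← mul_sub, norm_mul, norm_sub_rev]
        exact mul_le_mul_of_nonneg_left hz (norm_nonneg _)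
      rw [map_sub] at h2
      linarith
    by_cases hs : 0 ≤ RCLike.re (b i * w)
    · rw [abs_of_nonneg hs]
      refine herr w ?_
      simp only [hs, decide_true, Bool.not_true] at hfi hgi
      have : (f - g) (u i) - w = (f (u i) - c true) - (g (u i) - c false) := by
        rw [hw, sub_apply]; ring
      rw [this]
      exact (norm_sub_le _ _).trans (by linarith)
    · rw [abs_of_neg (not_le.1 hs)]
      have h3 := herr (-w) ?_
      · simpa using h3
      simp only [hs, decide_false, Bool.not_false] at hfi hgi
      have : (f - g) (u i) - -w = (f (u i) - c false) - (g (u i) - c true) := by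
        rw [hw, sub_apply]; ring
      rw [this]
      exact (norm_sub_le _ _).trans (by linarith)
  have hre := key a
  -- Rotating the coefficients by `-I` turns real parts into imaginary ones; adding both estimates
  -- loses `4 * r ≤ ‖w‖ / 2` against `4` times the norm, whence the constant `1 / 8`.
  have him := key fun i => (-RCLike.I : 𝕜) * a i
  have hI : ‖(-RCLike.I : 𝕜)‖ ≤ 1 := by
    rw [norm_neg]
    rcases RCLike.I_eq_zero_or_im_I_eq_one (K := 𝕜) with h0 | h0
    · simp [h0]
    · exact (RCLike.norm_I_of_ne_zero (fun h1 => by simp [h1] at h0)).le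
  have hIv : ‖∑ i ∈ F, ((-RCLike.I : 𝕜) * a i) • u i‖ ≤ ‖∑ i ∈ F, a i • u i‖ := by
    simp_rw [mul_smul]
    rw [← Finset.smul_sum, norm_smul]
    exact mul_le_of_le_one_left (norm_nonneg _) hI
  have hIa : ∑ i ∈ F, ‖(-RCLike.I : 𝕜) * a i‖ ≤ ∑ i ∈ F, ‖a i‖ :=
    Finset.sum_le_sum fun i _ => by
      rw [norm_mul]
      exact mul_le_of_le_one_left (norm_nonneg _) hI
  have hIm : ∀ i, RCLike.re ((-RCLike.I : 𝕜) * a i * w) = RCLike.im (a i * w) := fun i => by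
    rw [mul_assoc, neg_mul, map_neg, RCLike.I_mul_re, neg_neg]
  simp only [hIm] at him
  have htot : ‖w‖ * ∑ i ∈ F, ‖a i‖ ≤
      ∑ i ∈ F, |RCLike.re (a i * w)| + ∑ i ∈ F, |RCLike.im (a i * w)| := by
    rw [Finset.mul_sum, ← Finset.sum_add_distrib]
    refine Finset.sum_le_sum fun i _ => ?_
    rw [mul_comm, ← norm_mul]
    conv_lhs => rw [← RCLike.re_add_im (a i * w)]
    refine (norm_add_le _ _).trans (add_le_add (RCLike.norm_ofReal _).le ?_)
    rw [norm_mul, RCLike.norm_ofReal]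
    exact mul_le_of_le_one_right (abs_nonneg _) (by simpa using hI)
  have hA : 0 ≤ ∑ i ∈ F, ‖a i‖ := Finset.sum_nonneg fun i _ => norm_nonneg _
  by_cases hr0 : 0 ≤ r
  · have := mul_le_mul_of_nonneg_left hIa hr0
    have := mul_le_mul_of_nonneg_right hr hA
    linarith
  · rcases F.eq_empty_or_nonempty with rfl | ⟨i, hi⟩
    · simp
    · obtain ⟨f, -, hf⟩ := h fun _ => true
      exact absurd ((norm_nonneg _).trans (hf i hi)) hr0

/-- Rosenthal's `ℓ₁` theorem: in a Banach space without a copy of `ℓ₁`, bounded sequences have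
weakly Cauchy subsequences. -/
theorem exists_weaklyCauchy_subsequence [CompleteSpace X]
    (hX : ¬ ContainsCopy 𝕜 (SeqLp 𝕜 1) X) (x : ℕ → X) {K : ℝ} (hK : ∀ n, ‖x n‖ ≤ K) :
    ∃ m : ℕ → ℕ, StrictMono m ∧ ∀ f : X →L[𝕜] 𝕜, ∃ y, Tendsto (fun n => f (x (m n))) atTop (𝓝 y) := by
  classical
  have hU : (hyperfilter ℕ : Filter ℕ) ≤ atTop := Nat.hyperfilter_le_atTop
  let D : Bool → 𝕜 → 𝕜 → 𝕜 := fun b c d => if b then c else d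
  let C : 𝕜 → 𝕜 → ℝ → Bool → ℕ → Set (X →L[𝕜] 𝕜) := fun c d r b n =>
    {f | ‖f‖ ≤ 1 ∧ ‖f (x n) - D b c d‖ ≤ r}
  have tree : ∀ c d r, c ≠ d → 8 * r ≤ ‖c - d‖ → EventuallyHits (hyperfilter ℕ)
      {l | alternatingInter (C c d r) true l = ∅} [] := by
    intro c d r hcd hr
    by_contra hne
    obtain ⟨m, -, hind⟩ := exists_independent_of_not_eventuallyHits _ hU hne
    refine hX (containsCopy_of_lower_bound (fun n : ℕ+ => x (m n)) (K := K)
      (κ := ‖c - d‖ / 8) (by have := norm_pos_iff.2 (sub_ne_zero.2 hcd); positivity)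
      (fun n => hK _) fun F a => ?_)
    refine norm_sum_ge_of_separated F _ (fun b => D b c d) r (by simpa [D] using hr) (fun e => ?_) a
    -- The extra index `0` secures `‖f‖ ≤ 1` even when `F` is empty; its sign is immaterial.
    obtain ⟨f, hf⟩ := hind (insert 0 (F.image fun n : ℕ+ => (n : ℕ)))
      fun k => if hk : 0 < k then e ⟨k, hk⟩ else true
    refine ⟨f, (hf 0 (by simp)).1, fun i hi => ?_⟩
    have h1 := (hf i (by simp [hi])).2
    rw [dif_pos i.pos] at h1
    exact h1
  -- Centres from a countable dense set and radii `1 / (k + 1)` leave countably many trees, within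
  -- reach of one diagonal sequence.
  let ctr : ℕ → 𝕜 := TopologicalSpace.denseSeq 𝕜
  have htree : ∀ t : ℕ × ℕ × ℕ, ∃ g : List ℕ → Set ℕ, (∀ l, g l ∈ (hyperfilter ℕ : Filter ℕ)) ∧
      ((ctr t.1 ≠ ctr t.2.1 ∧ 8 * (1 / ((t.2.2 : ℝ) + 1)) ≤ ‖ctr t.1 - ctr t.2.1‖) →
        ∀ v : ℕ → ℕ, (∀ i, v i ∈ g ((List.range i).map v)) →
        ∃ i, alternatingInter (C (ctr t.1) (ctr t.2.1) (1 / ((t.2.2 : ℝ) + 1))) true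
          ((List.range i).map v) = ∅) := by
    intro t
    by_cases ht : ctr t.1 ≠ ctr t.2.1 ∧ 8 * (1 / ((t.2.2 : ℝ) + 1)) ≤ ‖ctr t.1 - ctr t.2.1‖
    · obtain ⟨g, hg, hgF⟩ := (tree _ _ _ ht.1 ht.2).exists_tree
      exact ⟨g, hg, fun _ v hv => by simpa using hgF v hv⟩
    · exact ⟨fun _ => Set.univ, fun _ => univ_mem, fun h => absurd h ht⟩
  choose g hg hgF using htree
  let e : ℕ × ℕ × ℕ ≃ ℕ := Denumerable.eqv _
  obtain ⟨m, hm, hmg⟩ := exists_diagonal_sequence hU (fun j => g (e.symm j)) fun j => hg _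
  refine ⟨m, hm, ?_⟩
  have unit : ∀ f : X →L[𝕜] 𝕜, ‖f‖ ≤ 1 → ∃ y, Tendsto (fun n => f (x (m n))) atTop (𝓝 y) := by
    intro f hf
    have hmem : ∀ n, f (x (m n)) ∈ Metric.closedBall (0 : 𝕜) K := fun n => by
      rw [mem_closedBall_zero_iff]
      exact (f.le_of_opNorm_le hf _).trans (by simpa using hK _)
    have hcomp : IsCompact (Metric.closedBall (0 : 𝕜) K) := isCompact_closedBall _ _
    obtain ⟨y, -, hy⟩ := hcomp.exists_mapClusterPt (f := atTop) (u := fun n => f (x (m n)))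
      (tendsto_principal.2 (Eventually.of_forall hmem))
    refine ⟨y, hcomp.tendsto_nhds_of_unique_mapClusterPt (Eventually.of_forall hmem)
      fun z _ hz => ?_⟩
    by_contra hzy
    have hpos : 0 < ‖z - y‖ := norm_pos_iff.2 (sub_ne_zero.2 hzy)
    -- Moving `z` and `y` to centres costs at most `2 * r`, so `20 * r < ‖z - y‖` amply yields the
    -- separation `8 * r`.
    obtain ⟨k, hk⟩ := exists_nat_one_div_lt (show 0 < ‖z - y‖ / 20 by positivity)
    have hk0 : (0 : ℝ) < 1 / ((k : ℝ) + 1) := by positivity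
    set r : ℝ := 1 / ((k : ℝ) + 1) with hr
    have hdense : ∀ p : 𝕜, ∃ i, ‖p - ctr i‖ < r := fun p => by
      obtain ⟨i, hi⟩ := (TopologicalSpace.denseRange_denseSeq 𝕜).exists_dist_lt p hk0
      exact ⟨i, by rwa [dist_eq_norm] at hi⟩
    obtain ⟨i₁, hi₁⟩ := hdense z
    obtain ⟨i₂, hi₂⟩ := hdense y
    have h3 : ‖z - y‖ ≤ ‖z - ctr i₁‖ + ‖ctr i₁ - ctr i₂‖ + ‖y - ctr i₂‖ := by
      have h4 : z - y = (z - ctr i₁) + (ctr i₁ - ctr i₂) - (y - ctr i₂) := by ring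
      rw [h4]
      exact (norm_sub_le _ _).trans (add_le_add (norm_add_le _ _) le_rfl)
    have hsep : 8 * r ≤ ‖ctr i₁ - ctr i₂‖ := by linarith
    have hne : ctr i₁ ≠ ctr i₂ := fun h => by rw [h, sub_self, norm_zero] at hsep; linarith
    have hfreq : ∀ b, ∃ᶠ n in atTop, f ∈ C (ctr i₁) (ctr i₂) r b (m n) := by
      have aux : ∀ (p q : 𝕜), MapClusterPt p atTop (fun n => f (x (m n))) → ‖p - q‖ < r →
          ∃ᶠ n in atTop, ‖f (x (m n)) - q‖ ≤ r := fun p q hp hpq => by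
        have : Metric.ball q r ∈ 𝓝 p := Metric.isOpen_ball.mem_nhds (by simpa [dist_eq_norm])
        refine (hp.frequently this).mono fun n hn => ?_
        rw [← dist_eq_norm]
        exact le_of_lt hn
      intro b
      cases b
      · exact (aux _ _ hy hi₂).mono fun n hn => ⟨hf, by simpa [D] using hn⟩
      · exact (aux _ _ hz hi₁).mono fun n hn => ⟨hf, by simpa [D] using hn⟩
    set j := e (i₁, i₂, k) with hj
    -- Visits near `z` and `y` are picked alternately, so `f` stays in every alternating
    -- intersection; `j ≤ n` because the diagonal sequence obeys tree `j` only from index `j` on.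
    obtain ⟨φ, hφ, hφP⟩ := extraction_forall_of_frequently
      (P := fun i n => f ∈ C (ctr i₁) (ctr i₂) r (xor true (i % 2 == 1)) (m n) ∧ j ≤ n)
      fun i => (hfreq _).and_eventually (eventually_ge_atTop j)
    obtain ⟨i, hi⟩ := hgF (i₁, i₂, k) ⟨hne, hsep⟩ (fun i => m (φ i)) fun i => by
      have := hmg (φ i) j (hφP i).2 ((List.range i).map φ)
        (List.pairwise_map.2 (List.pairwise_lt_range.imp fun h => hφ h)) fun a ha => by
          obtain ⟨b, hb, rfl⟩ := List.mem_map.1 ha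
          exact hφ (List.mem_range.1 hb)
      simpa [hj, Function.comp_def] using this
    have hin := mem_alternatingInter_map_range (C := C (ctr i₁) (ctr i₂) r) (x := f) i true
      (fun i => m (φ i)) fun k => (hφP k).1
    rw [hi] at hin
    exact hin
  intro f
  have hpos : (0 : ℝ) < ‖f‖ + 1 := by positivity
  obtain ⟨y, hy⟩ := unit (((‖f‖ + 1 : ℝ) : 𝕜)⁻¹ • f) (by
    rw [norm_smul, norm_inv, RCLike.norm_ofReal, abs_of_pos hpos, inv_mul_le_iff₀ hpos]
    linarith)
  refine ⟨((‖f‖ + 1 : ℝ) : 𝕜) * y, (hy.const_mul _).congr fun n => ?_⟩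
  have : ((‖f‖ + 1 : ℝ) : 𝕜) ≠ 0 := RCLike.ofReal_ne_zero.2 hpos.ne'
  rw [smul_apply, smul_eq_mul, mul_inv_cancel_left₀ this]

end Rosenthal

/-! ### Gliding hump in `ℓ_q` -/

section GlidingHump

variable {𝕜 : Type*} [RCLike 𝕜]

/-- Outside `G` the vectors `v + w k` and `w k` agree, so the difference of `q`-th powers is a
finite sum over `G`, where coordinatewise convergence suffices. -/
theorem lp_tendsto_norm_add_rpow {q : ℝ≥0∞} [Fact (1 ≤ q)] (hq : q ≠ ∞) (v : SeqLp 𝕜 q)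
    (w : ℕ+ → SeqLp 𝕜 q) (G : Finset ℕ+) (hv : ∀ i ∉ G, v i = 0)
    (hw : ∀ i, Tendsto (fun k => w k i) atTop (𝓝 0)) :
    Tendsto (fun k => ‖v + w k‖ ^ q.toReal - ‖w k‖ ^ q.toReal) atTop (𝓝 (‖v‖ ^ q.toReal)) := by
  have hq0 : 0 < q.toReal := ENNReal.toReal_pos (zero_lt_one.trans_le Fact.out).ne' hq
  have hvG : ∑ i ∈ G, lp.single q i (v i) = v := by
    ext j
    rw [lp.coeFn_sum, Finset.sum_apply]
    by_cases hj : j ∈ G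
    · rw [Finset.sum_eq_single_of_mem j hj fun i _ hij => by simp [hij.symm]]
      simp
    · rw [hv j hj]
      refine Finset.sum_eq_zero fun i hi => ?_
      have : j ≠ i := fun h => hj (h ▸ hi)
      simp [this]
  have hrw : ∀ k, ‖v + w k‖ ^ q.toReal - ‖w k‖ ^ q.toReal =
      ∑ i ∈ G, (‖v i + w k i‖ ^ q.toReal - ‖w k i‖ ^ q.toReal) := by
    intro k
    have h1 := lp.norm_sub_norm_compl_sub_single hq0 (v + w k) G
    have h2 := lp.norm_sub_norm_compl_sub_single hq0 (w k) G
    have h3 : v + w k - ∑ i ∈ G, lp.single q i ((v + w k) i) =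
        w k - ∑ i ∈ G, lp.single q i (w k i) := by
      have : ∑ i ∈ G, lp.single q i ((v + w k) i) =
          ∑ i ∈ G, lp.single q i (v i) + ∑ i ∈ G, lp.single q i (w k i) := by
        rw [← Finset.sum_add_distrib]
        exact Finset.sum_congr rfl fun i _ => by simp
      rw [this, hvG]
      abel
    rw [h3] at h1
    rw [Finset.sum_sub_distrib]
    simp only [lp.coeFn_add, Pi.add_apply] at h1
    linarith
  have hlim : ‖v‖ ^ q.toReal = ∑ i ∈ G, (‖v i + 0‖ ^ q.toReal - ‖(0 : 𝕜)‖ ^ q.toReal) := by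
    have h1 := lp.norm_sub_norm_compl_sub_single hq0 v G
    rw [hvG, sub_self, norm_zero, Real.zero_rpow hq0.ne', sub_zero] at h1
    simpa [Real.zero_rpow hq0.ne'] using h1
  simp only [hrw]
  rw [hlim]
  refine tendsto_finsetSum _ fun i _ => ?_
  exact ((tendsto_const_nhds.add (hw i)).norm.rpow_const (Or.inr hq0.le)).sub
    ((hw i).norm.rpow_const (Or.inr hq0.le))

theorem lp_exists_large_sum_of_finite_support {q : ℝ≥0∞} [Fact (1 ≤ q)] (hq : q ≠ ∞)
    (w : ℕ+ → SeqLp 𝕜 q) (hs : ∀ k, ∃ G : Finset ℕ+, ∀ i ∉ G, w k i = 0)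
    (hw : ∀ i, Tendsto (fun k => w k i) atTop (𝓝 0)) {δ : ℝ} (hδ : 0 < δ)
    (hwδ : ∀ k, δ ≤ ‖w k‖) (N : ℕ+) (n : ℕ) :
    ∃ F : Finset ℕ+, F.card = n ∧ (∀ k ∈ F, N ≤ k) ∧
      n * (δ / 2) ^ q.toReal ≤ ‖∑ k ∈ F, w k‖ ^ q.toReal := by
  classical
  have hq0 : 0 < q.toReal := ENNReal.toReal_pos (zero_lt_one.trans_le Fact.out).ne' hq
  choose G hG using hs
  induction n with
  | zero => exact ⟨∅, rfl, by simp, by simp [Real.zero_rpow hq0.ne']⟩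
  | succ n ih =>
    obtain ⟨F, hFn, hFN, hF⟩ := ih
    -- A far-out term adds asymptotically at least `δ ^ q`; keeping only `(δ / 2) ^ q` absorbs the
    -- error of the limit.
    have hlt : (δ / 2) ^ q.toReal < δ ^ q.toReal :=
      Real.rpow_lt_rpow (by positivity) (by linarith) hq0
    have hlim := lp_tendsto_norm_add_rpow hq (∑ k ∈ F, w k) w (F.biUnion G) (fun i hi => by
      rw [lp.coeFn_sum, Finset.sum_apply]
      refine Finset.sum_eq_zero fun k hk => hG k i fun h => hi ?_
      exact Finset.mem_biUnion.2 ⟨k, hk, h⟩) hw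
    have hev := hlim.eventually (lt_mem_nhds (show ‖∑ k ∈ F, w k‖ ^ q.toReal -
      (δ ^ q.toReal - (δ / 2) ^ q.toReal) < ‖∑ k ∈ F, w k‖ ^ q.toReal by linarith))
    have hev2 : ∀ᶠ k in atTop, ∀ a ∈ F, a < k :=
      (eventually_all_finset F).2 fun a _ => eventually_gt_atTop a
    obtain ⟨k, hk1, hk2, hk3⟩ := (hev.and (hev2.and (eventually_ge_atTop N))).exists
    have hkF : k ∉ F := fun h => lt_irrefl _ (hk2 k h)
    refine ⟨insert k F, by rw [Finset.card_insert_of_notMem hkF, hFn], fun a ha => ?_, ?_⟩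
    · rcases Finset.mem_insert.1 ha with rfl | ha
      · exact hk3
      · exact hFN a ha
    · rw [Finset.sum_insert hkF, add_comm (w k)]
      have := Real.rpow_le_rpow hδ.le (hwδ k) hq0.le
      push_cast
      linarith

theorem lp_exists_large_sum {q : ℝ≥0∞} [Fact (1 ≤ q)] (hq : q ≠ ∞)
    (w : ℕ+ → SeqLp 𝕜 q) (hw : ∀ i, Tendsto (fun k => w k i) atTop (𝓝 0)) {δ : ℝ} (hδ : 0 < δ)
    (hwδ : ∀ k, δ ≤ ‖w k‖) (N : ℕ+) (n : ℕ) :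
    ∃ F : Finset ℕ+, F.card = n ∧ (∀ k ∈ F, N ≤ k) ∧
      (n : ℝ) ^ (1 / q.toReal) * (δ / 4) ≤ ‖∑ k ∈ F, w k‖ + δ := by
  classical
  have hq0 : 0 < q.toReal := ENNReal.toReal_pos (zero_lt_one.trans_le Fact.out).ne' hq
  -- As `k ≥ 1`, each truncation error is below `δ / 2`, so truncated norms stay above `δ / 2`, and
  -- all errors together sum to at most `δ`.
  have happ : ∀ k : ℕ+, ∃ s : Finset ℕ+,
      ‖w k - ∑ i ∈ s, lp.single q i (w k i)‖ < δ * (1 / 2) ^ (k : ℕ) := by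
    intro k
    have h1 := (lp.hasSum_single hq (w k)).eventually
      (Metric.ball_mem_nhds (w k) (show 0 < δ * (1 / 2 : ℝ) ^ (k : ℕ) by positivity))
    obtain ⟨s, hs⟩ := h1.exists
    exact ⟨s, by rwa [dist_comm, dist_eq_norm] at hs⟩
  choose s hs using happ
  set w' : ℕ+ → SeqLp 𝕜 q := fun k => ∑ i ∈ s k, lp.single q i (w k i) with hw'
  have happ_lim : Tendsto (fun k : ℕ+ => δ * (1 / 2 : ℝ) ^ (k : ℕ)) atTop (𝓝 0) := by
    have h1 := (tendsto_pow_atTop_nhds_zero_of_lt_one (r := (1 / 2 : ℝ)) (by norm_num)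
      (by norm_num)).comp tendsto_PNat_val_atTop_atTop
    simpa using h1.const_mul δ
  have hq1 : q ≠ 0 := (zero_lt_one.trans_le (Fact.out : 1 ≤ q)).ne'
  obtain ⟨F, hFn, hFN, hF⟩ := lp_exists_large_sum_of_finite_support hq w'
    (fun k => ⟨s k, fun j hj => by
      rw [hw', lp.coeFn_sum, Finset.sum_apply]
      refine Finset.sum_eq_zero fun i hi => ?_
      have : j ≠ i := fun h => hj (h ▸ hi)
      simp [this]⟩)
    (fun i => by
      have h1 : Tendsto (fun k => (w k - w' k) i) atTop (𝓝 0) :=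
        squeeze_zero_norm (fun k => (lp.norm_apply_le_norm hq1 _ i).trans (hs k).le) happ_lim
      simpa using (hw i).sub h1)
    (half_pos hδ) (fun k => by
      have h1 := norm_sub_norm_le (w k) (w' k)
      have h2 : δ * (1 / 2 : ℝ) ^ (k : ℕ) ≤ δ * (1 / 2) := by
        refine mul_le_mul_of_nonneg_left ?_ hδ.le
        exact pow_le_of_le_one (by norm_num) (by norm_num) k.ne_zero
      have := hs k
      have := hwδ k
      linarith) N n
  refine ⟨F, hFn, hFN, ?_⟩
  have herr : ‖∑ k ∈ F, w' k‖ ≤ ‖∑ k ∈ F, w k‖ + δ := by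
    have h1 : ‖∑ k ∈ F, w k - ∑ k ∈ F, w' k‖ ≤ δ := by
      rw [← Finset.sum_sub_distrib]
      refine (norm_sum_le_of_le F fun k _ => (hs k).le).trans ?_
      rw [← Finset.mul_sum]
      refine mul_le_of_le_one_right hδ.le ?_
      have h2 : ∑ k ∈ F, (1 / 2 : ℝ) ^ (k : ℕ) =
          ∑ j ∈ F.map ⟨PNat.natPred, PNat.natPred_injective⟩, (1 / 2 : ℝ) / 2 * 2 * (1 / 2) ^ j := by
        rw [Finset.sum_map]
        refine Finset.sum_congr rfl fun k _ => ?_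
        rw [Function.Embedding.coeFn_mk, ← PNat.natPred_add_one k, pow_succ]
        simp
        ring
      rw [h2, ← Finset.mul_sum]
      have h3 := (hasSum_geometric_two).summable.sum_le_tsum
        (F.map ⟨PNat.natPred, PNat.natPred_injective⟩) fun i _ => by positivity
      rw [tsum_geometric_two] at h3
      linarith
    have h2 := norm_sub_norm_le (∑ k ∈ F, w' k) (∑ k ∈ F, w k)
    rw [norm_sub_rev] at h2
    linarith
  refine le_trans ?_ herr
  have h1 := Real.rpow_le_rpow (by positivity) hF (one_div_nonneg.2 hq0.le)
  rw [← Real.rpow_mul (norm_nonneg _), mul_one_div_cancel hq0.ne', Real.rpow_one,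
    Real.mul_rpow (by positivity) (by positivity), ← Real.rpow_mul (by positivity),
    mul_one_div_cancel hq0.ne', Real.rpow_one] at h1
  rw [show δ / 4 = δ / 2 / 2 by ring]
  exact h1

end GlidingHump

/-! ### Small far-out sets are Schreier -/

theorem isSchreier_of_card_le {s : Ordinal.{0} → ℕ+ → Ordinal.{0}} (hs : IsLimitSystem s)
    (n : ℕ) (ξ : Ordinal.{0}) : 1 ≤ ξ → ξ < Ordinal.omega 1 →
      ∃ N : ℕ+, ∀ F : Finset ℕ+, F.card ≤ n → (∀ k ∈ F, N ≤ k) → IsSchreier s ξ F := by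
  induction ξ using Ordinal.limitRecOn with
  | zero => intro h; simp at h
  | add_one η ih =>
    intro _ hη'
    rcases eq_or_ne η 0 with rfl | hη0
    · refine ⟨n.succPNat, fun F hF hN => ?_⟩
      have h1 : IsSchreier s 1 F := .one F fun k hk => by
        have h2 : n + 1 ≤ (k : ℕ) := by simpa using PNat.coe_le_coe _ _ |>.2 (hN k hk)
        omega
      simpa using h1
    -- One block is enough: a set in the family of `η` is its own one-term union.
    · have hη1 : 1 ≤ η := Order.one_le_iff_pos.2 (pos_iff_ne_zero.2 hη0)
      obtain ⟨N, hN⟩ := ih hη1 ((Order.lt_succ η).trans hη')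
      refine ⟨N, fun F hF hFN => ?_⟩
      rcases F.eq_empty_or_nonempty with rfl | hne
      · exact .empty _
      have h1 := IsSchreier.succ (s := s) η hη1 1 (fun _ => F) (fun _ => hne)
        (fun _ => hN F hF hFN) (fun i j hij => absurd hij (by omega)) (by
          intro k hk
          refine le_trans Finset.card_image_le ?_
          simpa using Nat.succ_le_of_lt k.pos)
      have h2 : (Finset.univ : Finset (Fin 1)).biUnion (fun _ => F) = F := by ext; simp
      rw [h2] at h1
      simpa using h1
  | limit ξ hξ ih =>
    intro _ hξ'
    obtain ⟨hmono, -, hlub⟩ := hs ξ hξ' hξ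
    -- Index 2 rather than 1, since `s ξ 1` may be 0, where the induction hypothesis is void.
    have hlt : s ξ 2 < ξ := (hmono (show (2 : ℕ+) < 3 by decide)).trans_le
      (hlub.1 (Set.mem_range_self 3))
    have hge : 1 ≤ s ξ 2 := Order.one_le_iff_pos.2
      (bot_le.trans_lt (hmono (show (1 : ℕ+) < 2 by decide)))
    obtain ⟨N, hN⟩ := ih (s ξ 2) hlt hge (hlt.trans hξ')
    exact ⟨max N 2, fun F hF hFN => .limit ξ hξ 2 F
      (hN F hF fun k hk => (le_max_left _ _).trans (hFN k hk))
      fun k hk => (le_max_right _ _).trans (hFN k hk)⟩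

/-! ### Compactness against the upper `ℓ_p` estimates -/

section Main

variable {𝕜 : Type*} [RCLike 𝕜]

theorem norm_toSeqLp_indicator_le {p : ℝ≥0∞} (hp : p ≠ 0) (F : Finset ℕ+) :
    ‖toSeqLp (𝕜 := 𝕜) p (Finsupp.indicator F fun _ _ => 1)‖ ≤
      (F.card : ℝ) ^ (1 / p.toReal) := by
  classical
  rcases eq_or_ne p ∞ with rfl | hp'
  · simp only [ENNReal.toReal_top, div_zero, Real.rpow_zero]
    refine lp.norm_le_of_forall_le zero_le_one fun i => ?_
    change ‖(Finsupp.indicator F fun _ _ => (1 : 𝕜)) i‖ ≤ 1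
    rw [Finsupp.indicator_apply]
    split_ifs <;> simp
  · have hp0 : 0 < p.toReal := ENNReal.toReal_pos hp hp'
    have h1 : HasSum (fun i => ‖toSeqLp (𝕜 := 𝕜) p (Finsupp.indicator F fun _ _ => 1) i‖ ^ p.toReal)
        (F.card : ℝ) := by
      have h2 : (F.card : ℝ) = ∑ i ∈ F,
          ‖toSeqLp (𝕜 := 𝕜) p (Finsupp.indicator F fun _ _ => 1) i‖ ^ p.toReal := by
        rw [Finset.card_eq_sum_ones, Nat.cast_sum]
        refine Finset.sum_congr rfl fun i hi => ?_
        change _ = ‖(Finsupp.indicator F fun _ _ => (1 : 𝕜)) i‖ ^ _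
        simp [Finsupp.indicator_apply, hi]
      rw [h2]
      refine hasSum_sum_of_ne_finset_zero fun i hi => ?_
      change ‖(Finsupp.indicator F fun _ _ => (1 : 𝕜)) i‖ ^ _ = 0
      simp [Finsupp.indicator_apply, hi, hp0.ne']
    rw [lp.norm_eq_tsum_rpow hp0, h1.tsum_eq]

variable {X : Type*} [NormedAddCommGroup X] [NormedSpace 𝕜 X]

/-- Compactness gives every subsequence a norm-convergent further subsequence, whose limit is killed
by all functionals. -/
theorem IsCompactOperator.tendsto_zero_of_weaklyNull {Y : Type*} [NormedAddCommGroup Y]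
    [NormedSpace 𝕜 Y] {T : X →L[𝕜] Y} (hT : IsCompactOperator T) {x : ℕ+ → X}
    (hx : IsNormalizedWeaklyNull 𝕜 x) : Tendsto (fun n => T (x n)) atTop (𝓝 0) := by
  refine tendsto_of_subseq_tendsto fun ns hns => ?_
  have hc := (isCompactOperator_iff_isCompact_closure_image_closedBall (𝕜₁ := 𝕜)
    (f := (T : X →ₗ[𝕜] Y)) zero_lt_one).1 hT
  obtain ⟨y, -, ms, hms, hy⟩ := hc.tendsto_subseq (x := fun n => T (x (ns n))) fun n =>
    subset_closure ⟨x (ns n), by simp [hx.1], rfl⟩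
  refine ⟨ms, ?_⟩
  have hy0 : y = 0 := by
    refine SeparatingDual.eq_zero_of_forall_dual_eq_zero (R := 𝕜) fun g => ?_
    refine tendsto_nhds_unique ((g.continuous.tendsto y).comp hy) ?_
    exact ((hx.2 (g.comp T)).comp hns).comp hms.tendsto_atTop
  rw [hy0] at hy
  exact hy

theorem IsCompactOperator.mem_finiteWD {Y : Type*} [NormedAddCommGroup Y] [NormedSpace 𝕜 Y]
    {T : X →L[𝕜] Y} (hT : IsCompactOperator T) (s : Ordinal.{0} → ℕ+ → Ordinal.{0})
    {p : ℝ≥0∞} (hp : p ≠ 0) (C : ℝ≥0) (ξ : Ordinal.{0}) : T ∈ finiteWD 𝕜 X Y s p C ξ := by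
  intro ε hε x hx
  have hlim := (hT.tendsto_zero_of_weaklyNull hx).norm
  rw [norm_zero] at hlim
  have hlim' : Tendsto (fun n : ℕ => ‖T (x n.succPNat)‖) atTop (𝓝 0) :=
    hlim.comp (tendsto_atTop_atTop.2 fun b => ⟨b, fun a ha => by
      rw [← PNat.coe_le_coe]; simp; omega⟩)
  obtain ⟨ψ, hψ, hψT⟩ := extraction_forall_of_eventually'
    (P := fun k n => ‖T (x n.succPNat)‖ ≤ ε / 2 * (1 / 2) ^ k) fun k =>
      eventually_atTop.1 (hlim'.eventually_le_const (by positivity))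
  refine ⟨fun k => (ψ k.natPred).succPNat, fun a b hab => ?_, fun α _ => ?_⟩
  · exact Nat.succPNat_strictMono (hψ (PNat.natPred_strictMono hab))
  have hα : ∀ k, ‖α k‖ ≤ ‖toSeqLp p α‖ := fun k => lp.norm_apply_le_norm hp (toSeqLp p α) k
  have h0 := (norm_nonneg _).trans (hα 1)
  calc ‖α.sum fun k a => a • T (x (ψ k.natPred).succPNat)‖
      ≤ ∑ k ∈ α.support, ‖toSeqLp p α‖ * (ε / 2 * (1 / 2) ^ k.natPred) := by
        refine norm_sum_le_of_le _ fun k _ => ?_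
        rw [norm_smul]
        exact mul_le_mul (hα k) (hψT _) (norm_nonneg _) h0
    _ = ‖toSeqLp p α‖ * (ε / 2) * ∑ j ∈ α.support.map ⟨PNat.natPred, PNat.natPred_injective⟩,
          (1 / 2) ^ j := by
        rw [Finset.sum_map, Finset.mul_sum]
        exact Finset.sum_congr rfl fun k _ => by rw [mul_assoc]; rfl
    _ ≤ ‖toSeqLp p α‖ * (ε / 2) * 2 := by
        refine mul_le_mul_of_nonneg_left ?_ (by positivity)
        refine le_of_le_of_eq ?_ tsum_geometric_two
        exact summable_geometric_two.sum_le_tsum _ fun i _ => by positivity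
    _ = ε * ‖toSeqLp p α‖ := by ring
    _ ≤ (C + ε) * ‖toSeqLp p α‖ :=
        mul_le_mul_of_nonneg_right (le_add_of_nonneg_left C.coe_nonneg) h0

/-- Operators in `WD` into `ℓ_q`, `q < p`, send normalized weakly null sequences to sequences that
are not bounded away from zero. -/
theorem not_bounded_below_of_mem_finiteWD {s : Ordinal.{0} → ℕ+ → Ordinal.{0}}
    (hs : IsLimitSystem s) {ξ : Ordinal.{0}} (hξ : 1 ≤ ξ) (hξ' : ξ < Ordinal.omega 1)
    {p q : ℝ≥0∞} [Fact (1 ≤ q)] (hqp : q < p) {C : ℝ≥0} {T : X →L[𝕜] SeqLp 𝕜 q}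
    (hT : T ∈ finiteWD 𝕜 X (SeqLp 𝕜 q) s p C ξ) {x : ℕ+ → X} (hx : IsNormalizedWeaklyNull 𝕜 x)
    {δ : ℝ} (hδ : 0 < δ) : ¬ ∀ n, δ ≤ ‖T (x n)‖ := by
  intro hxδ
  have hq : q ≠ ∞ := hqp.ne_top
  have hq1 : 0 < q := zero_lt_one.trans_le Fact.out
  have hq0 : 0 < q.toReal := ENNReal.toReal_pos hq1.ne' hq
  have hp : p ≠ 0 := (hq1.trans hqp).ne'
  obtain ⟨φ, hφ, hφT⟩ := hT 1 one_pos x hx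
  have hgap : 0 < 1 / q.toReal - 1 / p.toReal := by
    rcases eq_or_ne p ∞ with rfl | hp'
    · simpa using hq0
    · exact sub_pos.2 (one_div_lt_one_div_of_lt hq0 ((ENNReal.toReal_lt_toReal hq hp').2 hqp))
  have hup : ∀ n : ℕ, 1 ≤ n →
      (n : ℝ) ^ (1 / q.toReal - 1 / p.toReal) * (δ / 4) ≤ C + 1 + δ := by
    intro n hn
    obtain ⟨N, hN⟩ := isSchreier_of_card_le hs n ξ hξ hξ'
    obtain ⟨F, hFn, hFN, hF⟩ := lp_exists_large_sum hq (fun k => T (x (φ k)))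
      (fun i => (hx.2 ((lp.evalCLM 𝕜 (fun _ : ℕ+ => 𝕜) q i).comp T)).comp
        (tendsto_atTop_mono (fun _ => hφ.le_apply) tendsto_id))
      hδ (fun k => hxδ _) N n
    have hsupp : (Finsupp.indicator F fun _ _ => (1 : 𝕜)).support = F := by
      classical
      ext i
      simp [Finsupp.indicator_apply]
    have h1 := hφT (Finsupp.indicator F fun _ _ => 1) (by
      rw [hsupp]
      exact hN F hFn.le hFN)
    have h2 : ((Finsupp.indicator F fun _ _ => (1 : 𝕜)).sum fun k a => a • T (x (φ k))) =
        ∑ k ∈ F, T (x (φ k)) := by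
      rw [Finsupp.sum, hsupp]
      exact Finset.sum_congr rfl fun k hk => by simp [Finsupp.indicator_of_mem hk]
    rw [h2] at h1
    have h3 := norm_toSeqLp_indicator_le (𝕜 := 𝕜) hp F
    rw [hFn] at h3
    have hn0 : (0 : ℝ) < n := by exact_mod_cast hn
    have h4 : (1 : ℝ) ≤ (n : ℝ) ^ (1 / p.toReal) :=
      Real.one_le_rpow (by exact_mod_cast hn) (by positivity)
    -- Dividing by `n^(1/p) ≥ 1` leaves a left side growing with `n` and a fixed bound; the `1` in
    -- it is the chosen `ε`.
    rw [Real.rpow_sub hn0, div_mul_eq_mul_div, div_le_iff₀ (by positivity)]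
    have h5 := mul_le_mul_of_nonneg_left h3 (show (0 : ℝ) ≤ C + 1 by positivity)
    have h6 := mul_le_mul_of_nonneg_left h4 hδ.le
    linarith
  have hlim := ((tendsto_rpow_atTop hgap).comp tendsto_natCast_atTop_atTop).atTop_mul_const
    (show 0 < δ / 4 by positivity)
  obtain ⟨n, hn1, hn2⟩ := ((hlim.eventually_gt_atTop ((C : ℝ) + 1 + δ)).and
    (eventually_ge_atTop 1)).exists
  exact absurd (hup n hn2) (not_le.2 hn1)

/-- In a space without a copy of `ℓ₁`, an operator under which no normalized weakly null sequence
has image bounded away from zero is compact. -/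
theorem isCompactOperator_of_not_bounded_below [CompleteSpace X]
    (hX : ¬ ContainsCopy 𝕜 (SeqLp 𝕜 1) X) {Y : Type*} [NormedAddCommGroup Y] [NormedSpace 𝕜 Y]
    [CompleteSpace Y] (T : X →L[𝕜] Y)
    (hT : ∀ x : ℕ+ → X, IsNormalizedWeaklyNull 𝕜 x → ∀ δ > 0, ¬ ∀ n, δ ≤ ‖T (x n)‖) :
    IsCompactOperator T := by
  have hsub : ∀ y : ℕ → X, (∀ n, ‖y n‖ ≤ 1) →
      ∃ m : ℕ → ℕ, StrictMono m ∧ CauchySeq fun n => T (y (m n)) := by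
    intro y hy
    obtain ⟨m, hm, hmy⟩ := exists_weaklyCauchy_subsequence hX y hy
    refine ⟨m, hm, ?_⟩
    by_contra hnc
    rw [Metric.cauchySeq_iff] at hnc
    push Not at hnc
    obtain ⟨ε, hε, h⟩ := hnc
    choose a ha b hb hab using h
    have hz : ∀ n : ℕ, ε ≤ ‖T (y (m (a n)) - y (m (b n)))‖ := fun n => by
      rw [map_sub, ← dist_eq_norm]; exact hab n
    have hz2 : ∀ n : ℕ, ‖y (m (a n)) - y (m (b n))‖ ≤ 2 := fun n =>
      (norm_sub_le _ _).trans (by linarith [hy (m (a n)), hy (m (b n))])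
    have hK : 0 < ‖T‖ + 1 := by positivity
    have hzpos : ∀ n : ℕ, ε / (‖T‖ + 1) ≤ ‖y (m (a n)) - y (m (b n))‖ := fun n => by
      rw [div_le_iff₀' hK]
      refine (hz n).trans ((T.le_opNorm _).trans ?_)
      exact mul_le_mul_of_nonneg_right (by linarith) (norm_nonneg _)
    have hη : 0 < ε / (‖T‖ + 1) := by positivity
    set z : ℕ → X := fun n => y (m (a n)) - y (m (b n)) with hzdef
    have hzp : ∀ n, 0 < ‖z n‖ := fun n => hη.trans_le (hzpos n)
    -- The differences have norm at least `ε / (‖T‖ + 1)`, so normalizing keeps them weakly null,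
    -- and norm at most 2, so the images stay above `ε / 2`.
    refine hT (fun n : ℕ+ => ((‖z n‖ : ℝ) : 𝕜)⁻¹ • z n) ⟨fun n => ?_, fun f => ?_⟩ (ε / 2)
      (by positivity) fun n => ?_
    · rw [norm_smul, norm_inv, RCLike.norm_ofReal, abs_norm, inv_mul_cancel₀ (hzp n).ne']
    · obtain ⟨l, hl⟩ := hmy f
      have hat : Tendsto a atTop atTop := tendsto_atTop_mono ha tendsto_id
      have hbt : Tendsto b atTop atTop := tendsto_atTop_mono hb tendsto_id
      have h1 : Tendsto (fun n => f (z n)) atTop (𝓝 0) := by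
        have := (hl.comp hat).sub (hl.comp hbt)
        rw [sub_self] at this
        exact this.congr fun n => by simp [hzdef]
      have h2 : Tendsto (fun n : ℕ => (ε / (‖T‖ + 1))⁻¹ * ‖f (z n)‖) atTop (𝓝 0) := by
        simpa using h1.norm.const_mul (ε / (‖T‖ + 1))⁻¹
      refine squeeze_zero_norm (fun n => ?_) (h2.comp tendsto_PNat_val_atTop_atTop)
      rw [map_smul, norm_smul, norm_inv, RCLike.norm_ofReal, abs_norm]
      exact mul_le_mul_of_nonneg_right (inv_anti₀ hη (hzpos n)) (norm_nonneg _)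
    · rw [map_smul, norm_smul, norm_inv, RCLike.norm_ofReal, abs_norm, inv_mul_eq_div]
      exact div_le_div₀ (norm_nonneg _) (hz n) (hzp n) (hz2 n)
  rw [show (⇑T : X → Y) = ⇑(T : X →ₗ[𝕜] Y) from rfl,
    isCompactOperator_iff_isCompact_closure_image_closedBall (𝕜₁ := 𝕜) _ zero_lt_one]
  refine TotallyBounded.isCompact_of_isClosed (TotallyBounded.closure ?_) isClosed_closure
  by_contra hnt
  rw [Metric.totallyBounded_iff] at hnt
  push Not at hnt
  obtain ⟨ε, hε, h⟩ := hnt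
  -- Without total boundedness, an `ε`-separated sequence of images can be built greedily; it has no
  -- Cauchy subsequence.
  have hstep : ∀ t : Finset X, (∀ u ∈ t, ‖u‖ ≤ 1) → ∃ v, ‖v‖ ≤ 1 ∧ ∀ u ∈ t, ε ≤ dist (T u) (T v) := by
    intro t _
    classical
    have h1 := h (T '' t) (t.finite_toSet.image _)
    obtain ⟨_, ⟨v, hv, rfl⟩, hvt⟩ := Set.not_subset.1 h1
    refine ⟨v, by simpa using hv, fun u hu => ?_⟩
    by_contra hlt
    refine hvt (Set.mem_biUnion (Set.mem_image_of_mem T hu) ?_)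
    rw [Metric.mem_ball, dist_comm]
    exact not_le.1 hlt
  obtain ⟨y, hy, hyε⟩ := exists_seq_of_forall_finset_exists _ _ hstep
  obtain ⟨m, hm, hc⟩ := hsub y hy
  obtain ⟨N, hN⟩ := Metric.cauchySeq_iff.1 hc ε hε
  exact absurd (hN N le_rfl (N + 1) (Nat.le_succ N)) (not_lt.2 (hyε _ _ (hm (Nat.lt_succ_self N))))

end Main

theorem mainTheorem9 {𝕜 : Type*} [RCLike 𝕜]
    {X : Type*} [NormedAddCommGroup X] [NormedSpace 𝕜 X] [CompleteSpace X]
    (hX : ¬ ContainsCopy 𝕜 (SeqLp 𝕜 1) X)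
    (s : Ordinal.{0} → ℕ+ → Ordinal.{0}) (hs : IsLimitSystem s)
    (ξ : Ordinal.{0}) (hξ : 1 ≤ ξ) (hξ' : ξ < Ordinal.omega 1)
    (p q : ℝ≥0∞) [Fact (1 ≤ q)] (hqp : q < p) (C : ℝ≥0∞) :
    classWD 𝕜 X (SeqLp 𝕜 q) s p C ξ =
      {T : X →L[𝕜] SeqLp 𝕜 q | IsCompactOperator T} := by
  have hp : p ≠ 0 := (bot_le.trans_lt hqp).ne'
  have key : ∀ (D : ℝ≥0), finiteWD 𝕜 X (SeqLp 𝕜 q) s p D ξ =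
      {T : X →L[𝕜] SeqLp 𝕜 q | IsCompactOperator T} := fun D =>
    Set.Subset.antisymm
      (fun T hT => isCompactOperator_of_not_bounded_below hX T fun x hx δ hδ =>
        not_bounded_below_of_mem_finiteWD hs hξ hξ' hqp hT hx hδ)
      (fun T hT => IsCompactOperator.mem_finiteWD hT s hp D ξ)
  unfold classWD
  split_ifs
  · simp only [key, Set.iUnion_const]
  · exact key _
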